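/- Let $(X,d)$ be a metric space with a base point $e$, and let $p\neq q$ be points of $X$. Let $\mathrm{Lip}_0(X)$ be the space of Lipschitz functions $f\colon X\to\mathbb R$ with $f(e)=0$, normed by the least Lipschitz constant; for $x\in X$ let $\delta_x\in\mathrm{Lip}_0(X)^*$ be the evaluation $f\mapsto f(x)$; let $\mathcal F(X)$ be the norm-closed linear span of $\{\delta_x : x\in X\}$ in $\mathrm{Lip}_0(X)^*$, with closed unit ball $B_{\mathcal F(X)}$; and put $u_{pq}=(\delta_p-\delta_q)/d(p,q)\in\mathcal F(X)$. An extreme point of $B_{\mathcal F(X)}$ is called preserved if its canonical image in the bidual $\mathcal F(X)^{**}$ is an extreme point of the closed unit ball of $\mathcal F(X)^{**}$. For $r\in X$ put $\Delta(r)=d(r,p)+d(r,q)-d(p,q)\ge 0$, and denote by $\Delta\colon\beta X\to[0,\infty]$ also the unique continuous extension of this function to the Stone–Čech compactification $\beta X$ of $X$, where $X$ is regarded as a subset of $\beta X$. A point $\xi\in\beta X$ is said to lie strictly between $p$ and $q$ if $\Delta(\xi)=0$ and $\xi\notin\{p,q\}$. Then the following are equivalent: (i) $u_{pq}$ is a preserved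 extreme point of $B_{\mathcal F(X)}$; (ii) no point of $\beta X$ lies strictly between $p$ and $q$; (iii) for every $\varepsilon>0$ there is $\delta>0$ such that $d(p,r)+d(q,r)-d(p,q)\ge\delta$ for all $r\in X$ with $d(p,r)\ge\varepsilon$ and $d(q,r)\ge\varepsilon$. -/

import Mathlib

open scoped NNReal ENNReal

namespace LipFree

universe u

section Lip0

variable {X : Type u} [MetricSpace X]

/-- The real Lipschitz functions on `X` that vanish at the base point `e`, as a linear subspace
of all functions `X → ℝ`. -/
def lip0Submodule (e : X) : Submodule ℝ (X → ℝ) where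
  carrier := {f | f e = 0 ∧ ∃ K : ℝ≥0, LipschitzWith K f}
  zero_mem' := ⟨rfl, 0, LipschitzWith.const 0⟩
  add_mem' := by
    rintro f g ⟨hf, K, hK⟩ ⟨hg, M, hM⟩
    exact ⟨by simp [hf, hg], K + M, hK.add hM⟩
  smul_mem' := by
    rintro c f ⟨hf, K, hK⟩
    refine ⟨by simp [hf], ‖c‖₊ * K, LipschitzWith.of_dist_le_mul fun x y => ?_⟩
    have h := hK.dist_le_mul x y
    rw [Real.dist_eq] at h ⊢
    simp only [Pi.smul_apply, smul_eq_mul, NNReal.coe_mul, coe_nnnorm, Real.norm_eq_abs]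
    rw [← mul_sub, abs_mul, mul_assoc]
    exact mul_le_mul_of_nonneg_left h (abs_nonneg c)

/-- The space `Lip₀(X)` of the metric space `X` pointed at `e`. It is a separate type, so that it
does not inherit the topology of pointwise convergence; its norm is the best Lipschitz constant. -/
def Lip0 (e : X) : Type u := lip0Submodule e

variable {e : X}

noncomputable instance : AddCommGroup (Lip0 e) := inferInstanceAs (AddCommGroup (lip0Submodule e))

noncomputable instance : Module ℝ (Lip0 e) := inferInstanceAs (Module ℝ (lip0Submodule e))

instance : CoeFun (Lip0 e) (fun _ => X → ℝ) := ⟨fun f => f.1⟩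

@[simp] theorem Lip0.add_apply (f g : Lip0 e) (x : X) : (f + g) x = f x + g x := rfl

@[simp] theorem Lip0.smul_apply (c : ℝ) (f : Lip0 e) (x : X) : (c • f) x = c * f x := rfl

@[simp] theorem Lip0.zero_apply (x : X) : (0 : Lip0 e) x = 0 := rfl

theorem Lip0.apply_base (f : Lip0 e) : f e = 0 := f.2.1

theorem Lip0.ext {f g : Lip0 e} (h : ∀ x, f x = g x) : f = g := Subtype.ext (funext h)

/-- The set of Lipschitz constants of a function. -/
def lipConsts (f : X → ℝ) : Set ℝ := {K | 0 ≤ K ∧ ∀ x y, |f x - f y| ≤ K * dist x y}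

/-- The norm `L(f)` is the smallest Lipschitz constant of `f`. -/
noncomputable instance : Norm (Lip0 e) := ⟨fun f => sInf (lipConsts f)⟩

theorem Lip0.norm_le {f : Lip0 e} {K : ℝ} (hK : 0 ≤ K)
    (h : ∀ x y, |f x - f y| ≤ K * dist x y) : ‖f‖ ≤ K :=
  csInf_le ⟨0, fun _ hM => hM.1⟩ ⟨hK, h⟩

theorem Lip0.lipConsts_nonempty (f : Lip0 e) : (lipConsts f).Nonempty := by
  obtain ⟨K, hK⟩ := f.2.2
  exact ⟨K, K.2, fun x y => by simpa [Real.dist_eq] using hK.dist_le_mul x y⟩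

theorem Lip0.norm_nonneg' (f : Lip0 e) : 0 ≤ ‖f‖ :=
  Real.sInf_nonneg fun _ hK => hK.1

theorem Lip0.abs_sub_le (f : Lip0 e) (x y : X) : |f x - f y| ≤ ‖f‖ * dist x y := by
  rcases eq_or_ne x y with rfl | hxy
  · simp
  · have hd : 0 < dist x y := dist_pos.2 hxy
    rw [← div_le_iff₀ hd]
    exact le_csInf f.lipConsts_nonempty fun K hK => (div_le_iff₀ hd).2 (hK.2 x y)

theorem Lip0.norm_smul_le' (c : ℝ) (f : Lip0 e) : ‖c • f‖ ≤ |c| * ‖f‖ := by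
  refine Lip0.norm_le (mul_nonneg (abs_nonneg c) f.norm_nonneg') fun x y => ?_
  rw [Lip0.smul_apply, Lip0.smul_apply, ← mul_sub, abs_mul, mul_assoc]
  exact mul_le_mul_of_nonneg_left (f.abs_sub_le x y) (abs_nonneg c)

theorem Lip0.normedSpaceCore (e : X) : NormedSpace.Core ℝ (Lip0 e) where
  norm_nonneg f := f.norm_nonneg'
  norm_smul c f := by
    refine le_antisymm (Lip0.norm_smul_le' c f) ?_
    rw [Real.norm_eq_abs]
    rcases eq_or_ne c 0 with rfl | hc
    · simpa using Lip0.norm_nonneg' ((0 : ℝ) • f)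
    · have h := Lip0.norm_smul_le' c⁻¹ (c • f)
      rw [smul_smul, inv_mul_cancel₀ hc, one_smul, abs_inv] at h
      have hc' : 0 < |c| := abs_pos.2 hc
      calc |c| * ‖f‖ ≤ |c| * (|c|⁻¹ * ‖c • f‖) := mul_le_mul_of_nonneg_left h hc'.le
        _ = ‖c • f‖ := by rw [← mul_assoc, mul_inv_cancel₀ hc'.ne', one_mul]
  norm_triangle f g := by
    refine Lip0.norm_le (add_nonneg f.norm_nonneg' g.norm_nonneg') fun x y => ?_
    rw [Lip0.add_apply, Lip0.add_apply, add_sub_add_comm, add_mul]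
    exact (abs_add_le _ _).trans (add_le_add (f.abs_sub_le x y) (g.abs_sub_le x y))
  norm_eq_zero_iff f := by
    constructor
    · intro h
      refine Lip0.ext fun x => ?_
      have hx := f.abs_sub_le x e
      rw [h, zero_mul, f.apply_base, sub_zero] at hx
      exact abs_nonpos_iff.1 hx
    · rintro rfl
      exact le_antisymm (Lip0.norm_le le_rfl fun x y => by simp) (Lip0.norm_nonneg' _)

noncomputable instance : NormedAddCommGroup (Lip0 e) :=
  NormedAddCommGroup.ofCore (Lip0.normedSpaceCore e)

noncomputable instance : NormedSpace ℝ (Lip0 e) :=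
  NormedSpace.ofCore (Lip0.normedSpaceCore e)

/-- The evaluation functional `j(x) : f ↦ f(x)`, an element of the dual of `Lip₀(X)`. -/
noncomputable def evalAt (e x : X) : StrongDual ℝ (Lip0 e) :=
  LinearMap.mkContinuous
    { toFun := fun f => f x
      map_add' := fun f g => f.add_apply g x
      map_smul' := fun c f => f.smul_apply c x }
    (dist x e)
    (fun f => by simpa [f.apply_base, mul_comm] using f.abs_sub_le x e)

@[simp] theorem evalAt_apply (x : X) (f : Lip0 e) : evalAt e x f = f x := rfl

/-- The Lipschitz-free space `F(X)`: the closed linear span of the evaluation functionals in the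
dual of `Lip₀(X)`. -/
noncomputable def freeSpace (e : X) : Submodule ℝ (StrongDual ℝ (Lip0 e)) :=
  (Submodule.span ℝ (Set.range (evalAt e))).topologicalClosure

/-- The canonical map `X → F(X)`. -/
noncomputable def delta (e x : X) : freeSpace e :=
  ⟨evalAt e x, Submodule.le_topologicalClosure _ (Submodule.subset_span ⟨x, rfl⟩)⟩

/-- The elementary molecule `u_pq = (δ_p - δ_q) / d(p,q)` of `F(X)`. -/
noncomputable def molecule (e p q : X) : freeSpace e :=
  (dist p q)⁻¹ • (delta e p - delta e q)

end Lip0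

/-- `x` is a preserved extreme point of the closed unit ball of the real normed space `E`: it is an
extreme point of that ball, and its canonical image in the bidual of `E` is an extreme point of the
closed unit ball of the bidual. -/
def IsPreservedExtremePoint {E : Type u} [NormedAddCommGroup E] [NormedSpace ℝ E] (x : E) : Prop :=
  x ∈ Set.extremePoints ℝ (Metric.closedBall (0 : E) 1) ∧
    NormedSpace.inclusionInDoubleDual ℝ E x ∈
      Set.extremePoints ℝ (Metric.closedBall (0 : StrongDual ℝ (StrongDual ℝ E)) 1)

section Between

variable {X : Type u} [MetricSpace X]

/-- The excess `d(r,p) + d(r,q) - d(p,q)` in the triangle inequality. -/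
noncomputable def excess (p q r : X) : ℝ := dist r p + dist r q - dist p q

/-- The excess as a function with values in `[0,∞]`; no information is lost, as the excess is
nonnegative. -/
noncomputable def excessENN (p q r : X) : ℝ≥0∞ := ENNReal.ofReal (excess p q r)

theorem continuous_excessENN (p q : X) : Continuous (excessENN p q) :=
  ENNReal.continuous_ofReal.comp
    (((continuous_id.dist continuous_const).add (continuous_id.dist continuous_const)).sub
      continuous_const)

/-- The unique continuous extension of the excess to a map `βX → [0,∞]`. -/
noncomputable def excessStoneCech (p q : X) : StoneCech X → ℝ≥0∞ :=
  stoneCechExtend (continuous_excessENN p q)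

/-- The point `ξ` of `βX` lies strictly between the points `p` and `q` of `X`. -/
def LiesStrictlyBetween (p q : X) (ξ : StoneCech X) : Prop :=
  excessStoneCech p q ξ = 0 ∧ ξ ≠ stoneCechUnit p ∧ ξ ≠ stoneCechUnit q

end Between

end LipFree

/-! Everything passes through (iii). For (iii) ⇒ (i), let `u_pq = aΦ + bΨ` in the bidual ball. Since
`Lip₀(X)` maps onto the dual of `F(X)` (`dualPairing_surjective`), it suffices to identify the
restriction `φ` of `Φ` to `Lip₀(X)`. Any 1-Lipschitz `f` nearly norming `u_pq` nearly norms `φ`; so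
if `f + t h` is almost 1-Lipschitz, `t φ(h)` is almost nonpositive (`apply_le_of_perturbation`). A
function with `g(p) = g(q)` is, up to a constant, a part vanishing near `p` and `q` plus a part
living very close to them. Each part has its own `f`: by (iii), one with slope bounded below 1 away
from `p` and `q`; for the other, one constant near each of them. Hence `φ` kills every such `g`, and
`φ = u_pq`.

If (iii) fails, points `r` with excess tending to 0 write `u_pq` as a weighted mean of `u_pr` and
`u_rq`; weak-star limits give a nontrivial decomposition in the bidual, contradicting (i). The
equivalence of (ii) and (iii) is compactness of `βX`. -/

namespace LipFree

universe u

/-! ### Functionals on `Lip₀(X)` occurring in a decomposition of a molecule -/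

section Functional

variable {X : Type u} [MetricSpace X] {e : X}

/-- The element `h - h(e)` of `Lip₀(X)` defined by a Lipschitz function `h`. -/
def Lip0.ofFun (e : X) (h : X → ℝ) (hh : ∃ K : ℝ, ∀ x y, |h x - h y| ≤ K * dist x y) :
    Lip0 e :=
  ⟨fun x => h x - h e, sub_self _, by
    obtain ⟨K, hK⟩ := hh
    refine ⟨K.toNNReal, LipschitzWith.of_dist_le_mul fun x y => ?_⟩
    rw [Real.dist_eq, sub_sub_sub_cancel_right]
    exact (hK x y).trans (mul_le_mul_of_nonneg_right (Real.le_coe_toNNReal K) dist_nonneg)⟩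

@[simp] theorem Lip0.ofFun_apply (h : X → ℝ) (hh) (x : X) :
    Lip0.ofFun e h hh x = h x - h e := rfl

theorem Lip0.norm_ofFun_le {h : X → ℝ} (hh) {K : ℝ} (hK : 0 ≤ K)
    (hK' : ∀ x y, |h x - h y| ≤ K * dist x y) : ‖Lip0.ofFun e h hh‖ ≤ K :=
  Lip0.norm_le hK fun x y => by
    rw [ofFun_apply, ofFun_apply, sub_sub_sub_cancel_right]
    exact hK' x y

/-- A functional on `Lip₀(X)` of norm at most one that carries the weight `a` in a convex
combination, with another such functional, equal to the molecule of `p` and `q`. -/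
structure IsSummand (p q : X) (a : ℝ) (φ : StrongDual ℝ (Lip0 e)) : Prop where
  pos : 0 < a
  le_norm : ∀ f, φ f ≤ ‖f‖
  le_mul : ∀ f : Lip0 e, ‖f‖ ≤ 1 → a - 1 + (f p - f q) / dist p q ≤ a * φ f

variable {p q : X} {a : ℝ} {φ : StrongDual ℝ (Lip0 e)}

/-- Almost norming the molecule forces `φ(f) ≥ 1 - η/a`, while the Lipschitz bound gives `φ(f) + t
φ(h) ≤ 1 + κ`. -/
theorem IsSummand.apply_le_of_perturbation (hφ : IsSummand p q a φ) (hpq : p ≠ q)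
    {f h : X → ℝ} (hh) {t κ η : ℝ} (hκ : 0 ≤ κ)
    (hf : ∀ x y, |f x - f y| ≤ dist x y)
    (hfh : ∀ x y, |(f x + t * h x) - (f y + t * h y)| ≤ (1 + κ) * dist x y)
    (hη : (1 - η) * dist p q ≤ f p - f q) :
    t * φ (Lip0.ofFun e h hh) ≤ κ + η / a := by
  have hf' : ∀ x y, |f x - f y| ≤ 1 * dist x y := by simpa using hf
  have hd : 0 < dist p q := dist_pos.2 hpq
  have h1 := hφ.le_mul (Lip0.ofFun e f ⟨1, hf'⟩) (Lip0.norm_ofFun_le _ zero_le_one hf')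
  have h2 := (hφ.le_norm (Lip0.ofFun e (fun x => f x + t * h x) ⟨_, hfh⟩)).trans
    (Lip0.norm_ofFun_le _ (by linarith) hfh)
  have h3 : Lip0.ofFun e (fun x => f x + t * h x) ⟨_, hfh⟩
      = Lip0.ofFun e f ⟨1, hf'⟩ + t • Lip0.ofFun e h hh :=
    Lip0.ext fun x => by simp; ring
  rw [h3, map_add, map_smul, smul_eq_mul] at h2
  rw [Lip0.ofFun_apply, Lip0.ofFun_apply, sub_sub_sub_cancel_right] at h1
  have h4 : 1 - η ≤ (f p - f q) / dist p q := (le_div_iff₀ hd).2 hη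
  have h5 : 1 - η / a ≤ φ (Lip0.ofFun e f ⟨1, hf'⟩) := by
    have ha := hφ.pos
    have : a * (1 - η / a) ≤ a * φ (Lip0.ofFun e f ⟨1, hf'⟩) := by
      rw [mul_sub, mul_div_cancel₀ _ ha.ne']; linarith
    exact le_of_mul_le_mul_left this ha
  linarith

/-- The excess bound yields a 1-Lipschitz `f` that norms the molecule exactly and has slope at most
`1 - s` on every pair with a point far from `p` and `q`. That slack absorbs a small multiple of `h`.
-/
theorem IsSummand.apply_nonpos_of_vanishing (hφ : IsSummand p q a φ) (hpq : p ≠ q)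
    {ε δ : ℝ} (hδ : 0 < δ)
    (hex : ∀ r : X, ε ≤ dist p r → ε ≤ dist q r → δ ≤ excess p q r)
    {h : X → ℝ} (hh) {L : ℝ} (hL : 0 ≤ L) (hLip : ∀ x y, |h x - h y| ≤ L * dist x y)
    (h0 : ∀ x, dist p x < ε ∨ dist q x < ε → h x = 0) :
    φ (Lip0.ofFun e h hh) ≤ 0 := by
  have hd : 0 < dist p q := dist_pos.2 hpq
  set d := dist p q with hd_def
  -- With this `s`, the first branch of `f` below dominates the second at every far point.
  obtain ⟨s, hs0, hs1, hs⟩ : ∃ s : ℝ, 0 < s ∧ s < 1 ∧ (1 - s) * (d + δ) = d :=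
    ⟨δ / (d + δ), by positivity, (div_lt_one (by positivity)).2 (by linarith), by field_simp; ring⟩
  set f : X → ℝ := fun x => max ((1 - s) * dist x q) (d - dist x p) with hf_def
  have hf : ∀ x y, f x - f y ≤ dist x y := by
    intro x y
    have h1 := dist_triangle x y q
    have h2 := dist_triangle y x p
    rw [dist_comm y x] at h2
    have h3 : (1 - s) * (dist x q - dist y q) ≤ 1 * dist x y :=
      (mul_le_mul_of_nonneg_left (by linarith) (by linarith)).trans
        (mul_le_mul_of_nonneg_right (by linarith) dist_nonneg)
    rw [sub_le_iff_le_add]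
    refine max_le ?_ ?_
    · have := le_max_left ((1 - s) * dist y q) (d - dist y p)
      simp only [hf_def]; linarith
    · have := le_max_right ((1 - s) * dist y q) (d - dist y p)
      simp only [hf_def]; linarith
  have hfar : ∀ y, ε ≤ dist p y → ε ≤ dist q y → ∀ x,
      f x ≤ (1 - s) * (dist x y + dist y q) := by
    intro y hy1 hy2 x
    have h1 := hex y hy1 hy2
    refine max_le (mul_le_mul_of_nonneg_left (dist_triangle _ _ _) (by linarith)) ?_
    have h2 : (1 - s) * (d + δ) ≤ (1 - s) * (dist y p + dist y q) :=
      mul_le_mul_of_nonneg_left (by unfold excess at h1; linarith) (by linarith)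
    have h3 : (1 - s) * dist y p ≤ (1 - s) * (dist x y + dist x p) :=
      mul_le_mul_of_nonneg_left (by rw [dist_comm x y]; exact dist_triangle _ _ _) (by linarith)
    nlinarith [dist_nonneg (x := x) (y := p)]
  have hfar_eq : ∀ y, ε ≤ dist p y → ε ≤ dist q y → f y = (1 - s) * dist y q := fun y hy1 hy2 =>
    le_antisymm (by simpa using hfar y hy1 hy2 y) (le_max_left _ _)
  have hslack : ∀ x y, ε ≤ dist p y → ε ≤ dist q y → |f x - f y| ≤ (1 - s) * dist x y := by
    intro x y hy1 hy2
    rw [abs_le, hfar_eq y hy1 hy2]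
    refine ⟨?_, by linarith [hfar y hy1 hy2 x]⟩
    have h1 : (1 - s) * dist y q ≤ (1 - s) * (dist x y + dist x q) :=
      mul_le_mul_of_nonneg_left (by rw [dist_comm x y]; exact dist_triangle _ _ _) (by linarith)
    have h2 : (1 - s) * dist x q ≤ f x := le_max_left _ _
    linarith
  have hfabs : ∀ x y, |f x - f y| ≤ dist x y := fun x y =>
    abs_sub_le_iff.2 ⟨hf x y, by rw [dist_comm]; exact hf y x⟩
  have ht : 0 < s / (L + 1) := by positivity
  set t := s / (L + 1) with ht_def
  have htL : t * L ≤ s := by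
    rw [ht_def, div_mul_eq_mul_div, div_le_iff₀ (by linarith)]
    nlinarith
  have hstep : ∀ x y, ε ≤ dist p y → ε ≤ dist q y →
      |(f x + t * h x) - (f y + t * h y)| ≤ (1 + 0) * dist x y := by
    intro x y hy1 hy2
    have h1 := hslack x y hy1 hy2
    have h2 : |t * (h x - h y)| ≤ s * dist x y := by
      rw [abs_mul, abs_of_pos ht]
      calc t * |h x - h y| ≤ t * (L * dist x y) := mul_le_mul_of_nonneg_left (hLip x y) ht.le
        _ = t * L * dist x y := by ring
        _ ≤ s * dist x y := mul_le_mul_of_nonneg_right htL dist_nonneg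
    have h3 := abs_add_le (f x - f y) (t * (h x - h y))
    rw [show f x + t * h x - (f y + t * h y) = f x - f y + t * (h x - h y) by ring]
    linarith
  have hmain := hφ.apply_le_of_perturbation (e := e) hpq (f := f) (h := h) hh (t := t) (κ := 0)
    (η := 0) le_rfl hfabs (by
      intro x y
      by_cases hy : dist p y < ε ∨ dist q y < ε
      · by_cases hx : dist p x < ε ∨ dist q x < ε
        · simpa [h0 x hx, h0 y hy] using hfabs x y
        · push Not at hx
          rw [abs_sub_comm, dist_comm]
          exact hstep y x hx.1 hx.2
      · push Not at hy
        exact hstep x y hy.1 hy.2) (by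
      have h1 : f p = d := by
        simp only [hf_def, dist_self, sub_zero]
        exact max_eq_right (by nlinarith)
      have h2 : f q = 0 := by
        simp [hf_def, dist_comm q p, hd_def]
      rw [h1, h2]; linarith)
  rw [zero_div, add_zero] at hmain
  exact nonpos_of_mul_nonpos_right hmain ht

/-- Truncating the distance to `q` at `ρ` and `d - ρ` makes `f` constant on the `ρ`-balls about `p`
and `q`, at a cost of `2ρ` in `f p - f q`. Since `h` lives in the much smaller `ρ²`-balls, adding
`L⁻¹ h` raises the Lipschitz constant by at most `4ρ`. -/
theorem IsSummand.apply_le_of_supported (hφ : IsSummand p q a φ) (hpq : p ≠ q)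
    {ρ : ℝ} (hρ : 0 < ρ) (hρ1 : ρ ≤ 1 / 2) (hρ2 : ρ ≤ dist p q / 2)
    {h : X → ℝ} (hh) {L : ℝ} (hL : 0 < L) (hLip : ∀ x y, |h x - h y| ≤ L * dist x y)
    (hbd : ∀ x, |h x| ≤ L * ρ ^ 2)
    (h0 : ∀ x, ρ ^ 2 ≤ dist p x → ρ ^ 2 ≤ dist q x → h x = 0) :
    φ (Lip0.ofFun e h hh) ≤ L * (4 + 2 / (dist p q * a)) * ρ := by
  have hd : 0 < dist p q := dist_pos.2 hpq
  set d := dist p q with hd_def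
  set f : X → ℝ := fun x => max ρ (min (dist x q) (d - ρ)) with hf_def
  have hfp : ∀ x, dist p x ≤ ρ → f x = d - ρ := by
    intro x hx
    have := dist_triangle p x q
    simp only [hf_def]
    rw [min_eq_right (by linarith), max_eq_right (by linarith)]
  have hfq : ∀ x, dist q x ≤ ρ → f x = ρ := by
    intro x hx
    rw [dist_comm] at hx
    exact max_eq_left ((min_le_left _ _).trans hx)
  have hfabs : ∀ x y, |f x - f y| ≤ dist x y := by
    intro x y
    have h1 : LipschitzWith 1 f := by
      have := ((LipschitzWith.dist_left q).min_const (d - ρ)).const_max ρ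
      exact this
    simpa [Real.dist_eq] using h1.dist_le_mul x y
  have ht : 0 < L⁻¹ := by positivity
  have hth : ∀ x y, |L⁻¹ * (h x - h y)| ≤ dist x y := by
    intro x y
    rw [abs_mul, abs_of_pos ht, inv_mul_le_iff₀ hL]
    exact hLip x y
  have hth' : ∀ x, |L⁻¹ * h x| ≤ ρ ^ 2 := by
    intro x
    rw [abs_mul, abs_of_pos ht, inv_mul_le_iff₀ hL]
    exact hbd x
  have hball : ∀ z, (∀ x y, dist z x ≤ ρ → dist z y ≤ ρ → f x = f y) → ∀ x y,
      dist z x < ρ ^ 2 →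
      |(f x + L⁻¹ * h x) - (f y + L⁻¹ * h y)| ≤ (1 + 4 * ρ) * dist x y := by
    intro z hz x y hx
    have hxρ : dist z x ≤ ρ := by nlinarith
    rcases le_total (dist z y) ρ with hy | hy
    · rw [hz x y hxρ hy, show f y + L⁻¹ * h x - (f y + L⁻¹ * h y) = L⁻¹ * (h x - h y) by ring]
      nlinarith [hth x y, dist_nonneg (x := x) (y := y)]
    -- Here `x` and `y` are at least `ρ - ρ² ≥ ρ/2` apart, so the variation `2ρ²` of `L⁻¹ h` is at
    -- most `4ρ` times their distance.
    · have h1 := dist_triangle z x y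
      have h2 : ρ * (1 - ρ) ≤ dist x y := by nlinarith
      have h3 : 2 * ρ ^ 2 ≤ 4 * ρ * dist x y := by nlinarith
      rw [show f x + L⁻¹ * h x - (f y + L⁻¹ * h y)
        = (f x - f y) + (L⁻¹ * h x - L⁻¹ * h y) by ring]
      have h4 := abs_add_le (f x - f y) (L⁻¹ * h x - L⁻¹ * h y)
      have h5 := abs_sub (L⁻¹ * h x) (L⁻¹ * h y)
      linarith [hfabs x y, hth' x, hth' y]
  have hstep : ∀ x y, dist p x < ρ ^ 2 ∨ dist q x < ρ ^ 2 →
      |(f x + L⁻¹ * h x) - (f y + L⁻¹ * h y)| ≤ (1 + 4 * ρ) * dist x y := by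
    rintro x y (hx | hx)
    · exact hball p (fun x y hx hy => (hfp x hx).trans (hfp y hy).symm) x y hx
    · exact hball q (fun x y hx hy => (hfq x hx).trans (hfq y hy).symm) x y hx
  have hmain := hφ.apply_le_of_perturbation (e := e) hpq (f := f) (h := h) hh (t := L⁻¹)
    (κ := 4 * ρ) (η := 2 * ρ / d) (by positivity) hfabs (by
      intro x y
      by_cases hx : dist p x < ρ ^ 2 ∨ dist q x < ρ ^ 2
      · exact hstep x y hx
      by_cases hy : dist p y < ρ ^ 2 ∨ dist q y < ρ ^ 2
      · rw [abs_sub_comm, dist_comm]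
        exact hstep y x hy
      push Not at hx hy
      rw [h0 x hx.1 hx.2, h0 y hy.1 hy.2, mul_zero, add_zero, add_zero]
      nlinarith [hfabs x y, dist_nonneg (x := x) (y := y)]) (by
      rw [hfp p (by simpa using hρ.le), hfq q (by simpa using hρ.le), ← hd_def]
      have : (1 - 2 * ρ / d) * d = d - 2 * ρ := by field_simp
      linarith)
  rw [inv_mul_le_iff₀ hL] at hmain
  have ha := hφ.pos
  calc _ ≤ _ := hmain
    _ = _ := by field_simp

/-- Splitting `g` at scale `ρ²` bounds `φ g` by a constant times `ρ`, with the constant independent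
of `ρ`; then `ρ` tends to 0. -/
theorem IsSummand.apply_nonpos (hφ : IsSummand p q a φ) (hpq : p ≠ q)
    (hex : ∀ ε : ℝ, 0 < ε → ∃ δ : ℝ, 0 < δ ∧
        ∀ r : X, ε ≤ dist p r → ε ≤ dist q r → δ ≤ excess p q r)
    (g : Lip0 e) (hg : g p = g q) : φ g ≤ 0 := by
  have hd : 0 < dist p q := dist_pos.2 hpq
  have ha := hφ.pos
  obtain ⟨L, hL, hgL⟩ : ∃ L : ℝ, 0 < L ∧ ∀ x y, |g x - g y| ≤ L * dist x y :=
    ⟨‖g‖ + 1, by positivity, fun x y => (g.abs_sub_le x y).trans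
      (mul_le_mul_of_nonneg_right (by linarith) dist_nonneg)⟩
  have key : ∀ ρ : ℝ, 0 < ρ → ρ ≤ min (1 / 2) (dist p q / 2) →
      φ g ≤ L * (4 + 2 / (dist p q * a)) * ρ := by
    intro ρ hρ hρ'
    obtain ⟨hρ1, hρ2⟩ := le_min_iff.1 hρ'
    have hε : 0 < ρ ^ 2 := by positivity
    set ε := ρ ^ 2
    -- A tent around `z`: the distance to `z` up to `ε/2`, then back down to 0 at `ε`.
    set v : X → X → ℝ := fun z x => max 0 (min (dist x z) (ε - dist x z)) with hv_def
    have hv : ∀ z, LipschitzWith 1 (v z) := by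
      intro z
      have h1 : LipschitzWith 1 (fun x => dist x z) := LipschitzWith.dist_left z
      have h2 : LipschitzWith 1 (fun x => ε - dist x z) :=
        LipschitzWith.of_dist_le_mul fun x y => by
          have := h1.dist_le_mul x y
          rw [Real.dist_eq] at this ⊢
          rwa [sub_sub_sub_cancel_left, abs_sub_comm]
      simpa using (h1.min h2).const_max 0
    set w : X → ℝ := fun x => L * max (v p x) (v q x) with hw_def
    have hw0 : ∀ x, 0 ≤ w x := fun x =>
      mul_nonneg hL.le ((le_max_left _ _).trans (le_max_left _ _))
    have hwL : LipschitzWith L.toNNReal w := by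
      have h1 : LipschitzWith 1 (fun x => max (v p x) (v q x)) := by
        simpa using (hv p).max (hv q)
      refine LipschitzWith.of_dist_le_mul fun x y => ?_
      have := h1.dist_le_mul x y
      rw [Real.dist_eq] at this ⊢
      rw [hw_def, ← mul_sub, abs_mul, abs_of_pos hL, Real.coe_toNNReal _ hL.le]
      exact mul_le_mul_of_nonneg_left (by simpa using this) hL.le
    have hgL' : LipschitzWith L.toNNReal (fun x => g x - g p) :=
      LipschitzWith.of_dist_le_mul fun x y => by
        rw [Real.dist_eq, sub_sub_sub_cancel_right, Real.coe_toNNReal _ hL.le]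
        exact hgL x y
    -- Clamping between `±w` keeps the Lipschitz constant `L`. Within `ε/2` of `p` or `q` the clamp
    -- is inactive, because `g p = g q`, so the remainder `h₁` vanishes there.
    set h₂ : X → ℝ := fun x => max (-w x) (min (g x - g p) (w x)) with h₂_def
    have h₂L : ∀ x y, |h₂ x - h₂ y| ≤ L * dist x y := by
      intro x y
      have h1 : LipschitzWith L.toNNReal h₂ := by
        simpa using hwL.neg.max (hgL'.min hwL)
      simpa [Real.dist_eq, hL.le] using h1.dist_le_mul x y
    have hvle : ∀ z x, v z x ≤ ε := fun z x =>
      max_le hε.le ((min_le_right _ _).trans (by linarith [dist_nonneg (x := x) (y := z)]))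
    have h₂w : ∀ x, |h₂ x| ≤ w x := fun x =>
      abs_le.2 ⟨le_max_left _ _, max_le (by linarith [hw0 x]) (min_le_right _ _)⟩
    have hv_far : ∀ z x, ε ≤ dist z x → v z x = 0 := fun z x hx => by
      rw [dist_comm] at hx
      exact max_eq_left ((min_le_right _ _).trans (by linarith))
    have hv_near : ∀ z x, dist z x < ε / 2 → dist z x ≤ v z x := fun z x hx => by
      rw [dist_comm] at hx ⊢
      exact le_max_of_le_right (le_min le_rfl (by linarith))
    set h₁ : X → ℝ := fun x => (g x - g p) - h₂ x with h₁_def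
    have h₁L : ∀ x y, |h₁ x - h₁ y| ≤ (2 * L) * dist x y := by
      intro x y
      rw [h₁_def, show (g x - g p - h₂ x) - (g y - g p - h₂ y) = (g x - g y) - (h₂ x - h₂ y) by ring]
      linarith [abs_sub (g x - g y) (h₂ x - h₂ y), hgL x y, h₂L x y]
    have hsplit : g = Lip0.ofFun e h₁ ⟨_, h₁L⟩ + Lip0.ofFun e h₂ ⟨_, h₂L⟩ :=
      Lip0.ext fun x => by simp [h₁_def, g.apply_base]; ring
    obtain ⟨δ, hδ, hexδ⟩ := hex (ε / 2) (by positivity)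
    have hA := hφ.apply_nonpos_of_vanishing hpq hδ hexδ ⟨_, h₁L⟩ (by positivity) h₁L (by
      intro x hx
      have hle : |g x - g p| ≤ w x := by
        rcases hx with hx | hx
        · refine (hgL x p).trans (mul_le_mul_of_nonneg_left ?_ hL.le)
          rw [dist_comm]
          exact (hv_near p x hx).trans (le_max_left _ _)
        · rw [hg]
          refine (hgL x q).trans (mul_le_mul_of_nonneg_left ?_ hL.le)
          rw [dist_comm]
          exact (hv_near q x hx).trans (le_max_right _ _)
      rw [abs_le] at hle
      simp only [h₁_def, h₂_def]
      rw [min_eq_left hle.2, max_eq_right hle.1, sub_self])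
    have hB := hφ.apply_le_of_supported hpq hρ hρ1 hρ2 ⟨_, h₂L⟩ hL h₂L
      (fun x => (h₂w x).trans (mul_le_mul_of_nonneg_left (max_le (hvle p x) (hvle q x)) hL.le))
      (fun x hx1 hx2 => by
        have := h₂w x
        simp only [hw_def, hv_far p x hx1, hv_far q x hx2, max_self, mul_zero] at this
        exact abs_nonpos_iff.1 this)
    rw [hsplit, map_add]
    linarith
  have hm : 0 < min (1 / 2) (dist p q / 2) := by positivity
  have hC : 0 < L * (4 + 2 / (dist p q * a)) := by positivity
  set C := L * (4 + 2 / (dist p q * a))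
  by_contra! hpos
  have h1 := key (min (min (1 / 2) (dist p q / 2)) (φ g / (2 * C))) (by positivity)
    (min_le_left _ _)
  have h2 : C * min (min (1 / 2) (dist p q / 2)) (φ g / (2 * C)) ≤ C * (φ g / (2 * C)) :=
    mul_le_mul_of_nonneg_left (min_le_right _ _) hC.le
  have h3 : C * (φ g / (2 * C)) = φ g / 2 := by field_simp
  linarith

/-- Vanishing on the kernel of the molecule makes `φ` a multiple of it; the distance to `q`, normed
by both, fixes the factor 1. -/
theorem IsSummand.apply_eq (hφ : IsSummand p q a φ) (hpq : p ≠ q)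
    (hex : ∀ ε : ℝ, 0 < ε → ∃ δ : ℝ, 0 < δ ∧
        ∀ r : X, ε ≤ dist p r → ε ≤ dist q r → δ ≤ excess p q r)
    (g : Lip0 e) : φ g = (g p - g q) / dist p q := by
  have hd : 0 < dist p q := dist_pos.2 hpq
  have hL : ∀ x y, |dist x q - dist y q| ≤ 1 * dist x y := fun x y => by
    simpa using abs_dist_sub_le x y q
  set f : Lip0 e := Lip0.ofFun e (fun x => dist x q) ⟨1, hL⟩ with hf_def
  have hfn : ‖f‖ ≤ 1 := Lip0.norm_ofFun_le _ zero_le_one hL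
  have hfpq : f p - f q = dist p q := by simp [hf_def]
  have hφf : φ f = 1 := by
    refine le_antisymm ((hφ.le_norm f).trans hfn) ?_
    have := hφ.le_mul f hfn
    rw [hfpq, div_self hd.ne'] at this
    exact le_of_mul_le_mul_left (by linarith) hφ.pos
  have hzero : ∀ g : Lip0 e, g p = g q → φ g = 0 := fun g hg => by
    refine le_antisymm (hφ.apply_nonpos hpq hex g hg) ?_
    have := hφ.apply_nonpos hpq hex ((-1 : ℝ) • g) (by simp only [Lip0.smul_apply, hg])
    rw [map_smul, smul_eq_mul] at this
    linarith
  have h1 := hzero (g + (-((g p - g q) / dist p q)) • f) (by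
    simp only [Lip0.add_apply, Lip0.smul_apply]
    have : (g p - g q) / dist p q * (f p - f q) = g p - g q := by
      rw [hfpq, div_mul_cancel₀ _ hd.ne']
    linarith)
  rw [map_add, map_smul, hφf, smul_eq_mul] at h1
  linarith

end Functional

/-! ### Duality with the free space, and preserved extreme points -/

section Duality

variable {X : Type u} [MetricSpace X]

open Filter Topology

/-- The Lipschitz-free space `F(X)` as a type of its own. -/
def FreeSpace (e : X) : Type u := freeSpace e

noncomputable instance (e : X) : NormedAddCommGroup (FreeSpace e) :=
  inferInstanceAs (NormedAddCommGroup (freeSpace e))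

noncomputable instance (e : X) : NormedSpace ℝ (FreeSpace e) :=
  inferInstanceAs (NormedSpace ℝ (freeSpace e))

/-- The element `δ_x` of `F(X)`. -/
noncomputable def FreeSpace.delta (e x : X) : FreeSpace e := LipFree.delta e x

/-- The molecule `u_pq` of `F(X)`. -/
noncomputable def FreeSpace.molecule (e p q : X) : FreeSpace e :=
  (dist p q)⁻¹ • (FreeSpace.delta e p - FreeSpace.delta e q)

/-- The functional on `F(X)` given by a function in `Lip₀(X)`. -/
noncomputable def FreeSpace.functional {e : X} (f : Lip0 e) : StrongDual ℝ (FreeSpace e) :=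
  LinearMap.mkContinuous
    { toFun := fun m => m.1 f
      map_add' := fun _ _ => rfl
      map_smul' := fun _ _ => rfl }
    ‖f‖
    (fun m => by
      rw [mul_comm]
      exact ContinuousLinearMap.le_opNorm m.1 f)

/-- The canonical map from `Lip₀(X)` to the dual of `F(X)`. -/
noncomputable def dualPairing (e : X) : Lip0 e →L[ℝ] StrongDual ℝ (FreeSpace e) :=
  LinearMap.mkContinuous
    { toFun := FreeSpace.functional
      map_add' := fun f g => ContinuousLinearMap.ext fun m => m.1.map_add f g
      map_smul' := fun c f => ContinuousLinearMap.ext fun m => m.1.map_smul c f }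
    1
    (fun f => by
      rw [one_mul]
      refine ContinuousLinearMap.opNorm_le_bound (FreeSpace.functional f) (norm_nonneg f) fun m => ?_
      rw [mul_comm]
      exact ContinuousLinearMap.le_opNorm m.1 f)

variable {e : X}

@[simp] theorem dualPairing_apply (f : Lip0 e) (m : FreeSpace e) :
    dualPairing e f m = m.1 f := rfl

theorem norm_dualPairing_le (f : Lip0 e) : ‖dualPairing e f‖ ≤ ‖f‖ := by
  simpa using (dualPairing e).le_of_opNorm_le (LinearMap.mkContinuous_norm_le _ zero_le_one _) f

theorem norm_delta_sub_le (x y : X) : ‖FreeSpace.delta e x - FreeSpace.delta e y‖ ≤ dist x y := by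
  change ‖evalAt e x - evalAt e y‖ ≤ _
  refine ContinuousLinearMap.opNorm_le_bound _ dist_nonneg fun f => ?_
  rw [mul_comm]
  exact f.abs_sub_le x y

/-- A functional `l` comes from the function `x ↦ l(δ_x)`. After a Hahn–Banach extension of `l`, the
two functionals agree on evaluations, hence on their closed span. -/
theorem dualPairing_surjective : Function.Surjective (dualPairing e) := by
  intro l
  have hL : ∀ x y, |l (FreeSpace.delta e x) - l (FreeSpace.delta e y)| ≤ ‖l‖ * dist x y := fun x y => by
    rw [← map_sub, ← Real.norm_eq_abs]
    exact (l.le_opNorm _).trans (mul_le_mul_of_nonneg_left (norm_delta_sub_le x y) (norm_nonneg _))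
  refine ⟨Lip0.ofFun e (fun x => l (FreeSpace.delta e x)) ⟨_, hL⟩, ?_⟩
  obtain ⟨l', hl', -⟩ := exists_extension_norm_eq (freeSpace e) l
  have hde : FreeSpace.delta e e = 0 := Subtype.ext (ContinuousLinearMap.ext fun f => f.apply_base)
  have hle : freeSpace e ≤ (NormedSpace.inclusionInDoubleDual ℝ (Lip0 e)
      (Lip0.ofFun e (fun x => l (FreeSpace.delta e x)) ⟨_, hL⟩) - l').ker := by
    refine Submodule.topologicalClosure_minimal _ (Submodule.span_le.2 ?_)
      (ContinuousLinearMap.isClosed_ker _)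
    rintro _ ⟨x, rfl⟩
    have hx : l' (evalAt e x) = l (FreeSpace.delta e x) := hl' (FreeSpace.delta e x)
    simp [hx, hde]
  ext m
  exact (sub_eq_zero.1 (hle m.2)).trans (hl' m)

theorem molecule_apply (p q : X) (f : Lip0 e) :
    (FreeSpace.molecule e p q).1 f = (f p - f q) / dist p q := by
  rw [div_eq_inv_mul]; rfl

theorem norm_molecule_le (p q : X) : ‖FreeSpace.molecule e p q‖ ≤ 1 := by
  rw [FreeSpace.molecule, norm_smul, norm_inv, Real.norm_of_nonneg dist_nonneg]
  exact inv_mul_le_one_of_le₀ (norm_delta_sub_le p q) dist_nonneg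

theorem mem_closedBall_dual_iff {E : Type*} [NormedAddCommGroup E] [NormedSpace ℝ E]
    {φ : StrongDual ℝ E} : φ ∈ Metric.closedBall (0 : StrongDual ℝ E) 1 ↔ ‖φ‖ ≤ 1 :=
  mem_closedBall_zero_iff (E := StrongDual ℝ E)

theorem isPreservedExtremePoint_of_bidual {E : Type u} [NormedAddCommGroup E] [NormedSpace ℝ E]
    {x : E} (hx : NormedSpace.inclusionInDoubleDual ℝ E x ∈
      Set.extremePoints ℝ (Metric.closedBall (0 : StrongDual ℝ (StrongDual ℝ E)) 1)) :
    IsPreservedExtremePoint x := by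
  have hmem : ∀ y : E, y ∈ Metric.closedBall (0 : E) 1 ↔ NormedSpace.inclusionInDoubleDual ℝ E y ∈
      Metric.closedBall (0 : StrongDual ℝ (StrongDual ℝ E)) 1 := fun y => by
    refine mem_closedBall_zero_iff.trans (Iff.trans ?_ mem_closedBall_dual_iff.symm)
    exact iff_of_eq (congrArg (· ≤ 1) ((NormedSpace.inclusionInDoubleDualLi ℝ).norm_map y).symm)
  refine ⟨⟨(hmem x).2 hx.1, fun y hy z hz hxyz => ?_⟩, hx⟩
  obtain ⟨a, b, ha, hb, hab, rfl⟩ := hxyz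
  exact (NormedSpace.inclusionInDoubleDualLi ℝ).injective
    (hx.2 ((hmem y).1 hy) ((hmem z).1 hz) ⟨a, b, ha, hb, hab, by
      rw [map_add, map_smul, map_smul]; rfl⟩)

variable {p q : X}

theorem isPreservedExtremePoint_molecule (hpq : p ≠ q)
    (hex : ∀ ε : ℝ, 0 < ε → ∃ δ : ℝ, 0 < δ ∧
        ∀ r : X, ε ≤ dist p r → ε ≤ dist q r → δ ≤ excess p q r) :
    IsPreservedExtremePoint (FreeSpace.molecule e p q) := by
  refine isPreservedExtremePoint_of_bidual ⟨?_, fun Φ hΦ Ψ hΨ hseg => ?_⟩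
  · exact mem_closedBall_dual_iff.2
      ((NormedSpace.double_dual_bound ℝ _ _).trans (norm_molecule_le p q))
  obtain ⟨a, b, ha, hb, hab, hΦΨ⟩ := hseg
  have hball : ∀ Θ ∈ Metric.closedBall (0 : StrongDual ℝ (StrongDual ℝ (FreeSpace e))) 1,
      ∀ f, Θ (dualPairing e f) ≤ ‖f‖ := fun Θ hΘ f => by
    have hΘ1 : ‖Θ‖ ≤ 1 := mem_closedBall_dual_iff.1 hΘ
    refine (Real.le_norm_self _).trans ((Θ.le_of_opNorm_le hΘ1 _).trans ?_)
    rw [one_mul]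
    exact norm_dualPairing_le f
  have hφ : IsSummand p q a (Φ.comp (dualPairing e)) := by
    refine ⟨ha, hball Φ hΦ, fun f hf => ?_⟩
    have h1 := congrArg (fun Θ => Θ (dualPairing e f)) hΦΨ
    simp only [add_apply, smul_apply, smul_eq_mul,
      NormedSpace.dual_def, dualPairing_apply, molecule_apply] at h1
    -- Only this upper bound on the other summand, with `b = 1 - a`, is needed.
    have h2 : b * Ψ (dualPairing e f) ≤ b * 1 :=
      mul_le_mul_of_nonneg_left ((hball Ψ hΨ f).trans hf) hb.le
    rw [ContinuousLinearMap.comp_apply, ← h1]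
    linarith
  ext l
  obtain ⟨f, rfl⟩ := dualPairing_surjective l
  rw [NormedSpace.dual_def, dualPairing_apply, molecule_apply]
  exact hφ.apply_eq hpq hex f

/-- The bidual ball is weak-star compact. -/
theorem exists_bidual_limit {E ι : Type*} [NormedAddCommGroup E] [NormedSpace ℝ E]
    (U : Ultrafilter ι) (u : ι → E) (hu : ∀ i, ‖u i‖ ≤ 1) :
    ∃ Φ ∈ Metric.closedBall (0 : StrongDual ℝ (StrongDual ℝ E)) 1,
      ∀ l : StrongDual ℝ E, Tendsto (fun i => l (u i)) U (𝓝 (Φ l)) := by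
  obtain ⟨Φ, hΦ, hlim⟩ := (WeakDual.isCompact_closedBall
    (0 : StrongDual ℝ (StrongDual ℝ E)) 1).ultrafilter_le_nhds'
    (U.map fun i => StrongDual.toWeakDual (NormedSpace.inclusionInDoubleDual ℝ E (u i)))
    (Ultrafilter.mem_map.2 (Filter.univ_mem' fun i => by
      have h := (NormedSpace.double_dual_bound ℝ E (u i)).trans (hu i)
      simpa using h))
  refine ⟨WeakDual.toStrongDual Φ, hΦ, fun l => ?_⟩
  exact ((WeakDual.eval_continuous l).tendsto Φ).comp hlim

theorem exists_real_limit {ι : Type*} (U : Ultrafilter ι) (u : ι → ℝ) {a b : ℝ}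
    (hu : ∀ i, u i ∈ Set.Icc a b) : ∃ c ∈ Set.Icc a b, Tendsto u U (𝓝 c) := by
  obtain ⟨c, hc, hlim⟩ := (isCompact_Icc (a := a) (b := b)).ultrafilter_le_nhds' (U.map u)
    (Ultrafilter.mem_map.2 (Filter.univ_mem' hu))
  exact ⟨c, hc, hlim⟩

theorem excess_nonneg (p q r : X) : 0 ≤ excess p q r := by
  unfold excess
  linarith [dist_triangle_left p q r]

theorem exists_seq_excess_tendsto_zero {ε : ℝ}
    (h : ∀ δ : ℝ, 0 < δ → ∃ r : X, ε ≤ dist p r ∧ ε ≤ dist q r ∧ excess p q r < δ) :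
    ∃ r : ℕ → X, (∀ n, ε ≤ dist p (r n)) ∧ (∀ n, ε ≤ dist q (r n)) ∧
      (∀ n, excess p q (r n) ≤ 1) ∧ Tendsto (fun n => excess p q (r n)) atTop (𝓝 0) := by
  choose r hr using fun n : ℕ => h (1 / ((n : ℝ) + 1)) (by positivity)
  refine ⟨r, fun n => (hr n).1, fun n => (hr n).2.1, fun n => (hr n).2.2.le.trans ?_,
    squeeze_zero (fun n => excess_nonneg _ _ _) (fun n => (hr n).2.2.le)
      tendsto_one_div_add_atTop_nhds_zero_nat⟩
  rw [div_le_one (by positivity)]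
  linarith [(Nat.cast_nonneg n : (0 : ℝ) ≤ n)]

/-- Otherwise `u_pr` and `u_rq` have weak-star limits along an ultrafilter, with weights tending to
`α/d` and `(d - α)/d`, both positive. Extremality makes the first limit `u_pq`, which a truncated
distance to `p` refutes. -/
theorem excess_bound_of_isPreservedExtremePoint (hpq : p ≠ q)
    (hu : IsPreservedExtremePoint (FreeSpace.molecule e p q)) {ε : ℝ} (hε : 0 < ε) :
    ∃ δ : ℝ, 0 < δ ∧ ∀ r : X, ε ≤ dist p r → ε ≤ dist q r → δ ≤ excess p q r := by
  by_contra! hcon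
  obtain ⟨r, hrp, hrq, hr1, hr0⟩ := exists_seq_excess_tendsto_zero hcon
  have hd : 0 < dist p q := dist_pos.2 hpq
  have hU : (hyperfilter ℕ : Filter ℕ) ≤ atTop := Nat.hyperfilter_le_atTop
  obtain ⟨Φ, hΦ, hΦlim⟩ := exists_bidual_limit (hyperfilter ℕ)
    (fun n => FreeSpace.molecule e p (r n)) fun n => norm_molecule_le _ _
  obtain ⟨Ψ, hΨ, hΨlim⟩ := exists_bidual_limit (hyperfilter ℕ)
    (fun n => FreeSpace.molecule e (r n) q) fun n => norm_molecule_le _ _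
  obtain ⟨α, ⟨hα, -⟩, hαlim⟩ := exists_real_limit (hyperfilter ℕ) (fun n => dist p (r n))
    (a := ε) (b := dist p q + 1) fun n => ⟨hrp n, by
      have := hr1 n
      unfold excess at this
      rw [dist_comm p (r n)]
      linarith [dist_nonneg (x := r n) (y := q)]⟩
  have hβlim : Tendsto (fun n => dist (r n) q) (hyperfilter ℕ) (𝓝 (dist p q - α)) := by
    have := ((hr0.mono_left hU).add_const (dist p q)).sub hαlim
    simp only [excess, dist_comm p (r _), zero_add] at this
    refine this.congr fun n => by ring
  have hβ : ε ≤ dist p q - α :=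
    ge_of_tendsto hβlim (Eventually.of_forall fun n => by rw [dist_comm]; exact hrq n)
  have hα0 : 0 < α := by linarith
  have hβ0 : 0 < dist p q - α := by linarith
  have heq : Φ = NormedSpace.inclusionInDoubleDual ℝ (FreeSpace e) (FreeSpace.molecule e p q) := by
    refine hu.2.2 hΦ hΨ ⟨α / dist p q, (dist p q - α) / dist p q, by positivity, by positivity,
      by field_simp; ring, ?_⟩
    ext l
    obtain ⟨f, rfl⟩ := dualPairing_surjective l
    have h1 := (hαlim.mul (hΦlim (dualPairing e f))).add (hβlim.mul (hΨlim (dualPairing e f)))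
    simp only [dualPairing_apply, molecule_apply] at h1
    -- Before the limit this is the telescoping `(f p - f r) + (f r - f q)`.
    have h2 : α * Φ (dualPairing e f) + (dist p q - α) * Ψ (dualPairing e f) = f p - f q := by
      refine tendsto_nhds_unique h1 (tendsto_const_nhds.congr fun n => ?_)
      rw [mul_div_cancel₀ _ (by linarith [hrp n]), mul_div_cancel₀ _
        (by rw [dist_comm]; linarith [hrq n])]
      ring
    simp only [add_apply, smul_apply, smul_eq_mul,
      NormedSpace.dual_def, dualPairing_apply, molecule_apply]
    rw [← h2]
    ring
  -- This test function equals `ε` at `q` and at all `r n`, so it gives `-ε/d` on `u_pq` but `-ε/α`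
  -- in the limit, although `α < d`.
  have hL : ∀ x y : X, |min (dist x p) ε - min (dist y p) ε| ≤ 1 * dist x y := fun x y => by
    simpa [Real.dist_eq] using ((LipschitzWith.dist_left p).min_const ε).dist_le_mul x y
  have h1 := hΦlim (dualPairing e (Lip0.ofFun e (fun x => min (dist x p) ε) ⟨1, hL⟩))
  rw [heq] at h1
  simp only [NormedSpace.dual_def, dualPairing_apply, molecule_apply, Lip0.ofFun_apply,
    sub_sub_sub_cancel_right, dist_self, min_eq_left hε.le,
    min_eq_right (show ε ≤ dist q p by rw [dist_comm]; linarith)] at h1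
  have h2 : Tendsto (fun n => (0 - ε) / dist p (r n)) (hyperfilter ℕ) (𝓝 ((0 - ε) / α)) :=
    tendsto_const_nhds.div hαlim hα0.ne'
  have h3 := tendsto_nhds_unique h2 (h1.congr fun n => by
    rw [min_eq_right (show ε ≤ dist (r n) p by rw [dist_comm]; exact hrp n)])
  rw [div_eq_div_iff hα0.ne' hd.ne'] at h3
  nlinarith

end Duality

/-! ### Points of `βX` strictly between `p` and `q` -/

section StoneCechCompactification

open Filter Topology

variable {X : Type u} [MetricSpace X] {p q : X}

theorem tendsto_stoneCechExtend {ι K : Type*} [TopologicalSpace K] [CompactSpace K] [T2Space K]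
    {g : X → K} (hg : Continuous g) {l : Filter ι} {r : ι → X} {ξ : StoneCech X}
    (h : Tendsto (fun i => stoneCechUnit (r i)) l (𝓝 ξ)) :
    Tendsto (fun i => g (r i)) l (𝓝 (stoneCechExtend hg ξ)) := by
  have := ((continuous_stoneCechExtend hg).tendsto ξ).comp h
  simpa [Function.comp_def] using this

/-- An ultrafilter on `X` converging to such a `ξ` has excess tending to 0, so it concentrates near
`{p, q}`; but it stays away from each of the two points, since it converges to neither. -/
theorem not_liesStrictlyBetween
    (hex : ∀ ε : ℝ, 0 < ε → ∃ δ : ℝ, 0 < δ ∧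
        ∀ r : X, ε ≤ dist p r → ε ≤ dist q r → δ ≤ excess p q r)
    (ξ : StoneCech X) : ¬ LiesStrictlyBetween p q ξ := by
  rintro ⟨h0, hξp, hξq⟩
  have : (comap stoneCechUnit (𝓝 ξ) : Filter X).NeBot := comap_neBot fun t ht => by
    obtain ⟨_, hy, x, rfl⟩ := mem_closure_iff_nhds.1 (denseRange_stoneCechUnit ξ) t ht
    exact ⟨x, hy⟩
  set U : Ultrafilter X := Ultrafilter.of (comap stoneCechUnit (𝓝 ξ))
  have hU : Tendsto stoneCechUnit (U : Filter X) (𝓝 ξ) :=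
    tendsto_comap.mono_left (Ultrafilter.of_le _)
  have hex0 : Tendsto (excessENN p q) (U : Filter X) (𝓝 0) :=
    h0 ▸ tendsto_stoneCechExtend (continuous_excessENN p q) hU
  have hnear : ∀ ε : ℝ, 0 < ε → ∀ᶠ r in (U : Filter X), dist p r < ε ∨ dist q r < ε := by
    intro ε hε
    obtain ⟨δ, hδ, hδε⟩ := hex ε hε
    filter_upwards [hex0.eventually (gt_mem_nhds (ENNReal.ofReal_pos.2 hδ))] with r hr
    by_contra! hcon
    exact absurd (ENNReal.ofReal_le_ofReal (hδε r hcon.1 hcon.2)) (not_le.2 hr)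
  have hnot : ∀ z : X, ξ ≠ stoneCechUnit z → ∃ ε : ℝ, 0 < ε ∧
      ∀ᶠ r in (U : Filter X), ε ≤ dist z r := by
    intro z hz
    by_contra! hcon
    have hz' : Tendsto id (U : Filter X) (𝓝 z) := by
      refine Metric.tendsto_nhds.2 fun ε hε => ?_
      filter_upwards [hcon ε hε] with r hr
      rw [dist_comm]
      exact hr
    exact hz (tendsto_nhds_unique hU ((continuous_stoneCechUnit.tendsto z).comp hz'))
  obtain ⟨ε₁, hε₁, h₁⟩ := hnot p hξp
  obtain ⟨ε₂, hε₂, h₂⟩ := hnot q hξq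
  obtain ⟨r, ⟨hr, hr₁⟩, hr₂⟩ := (((hnear _ (lt_min hε₁ hε₂)).and h₁).and h₂).exists
  rcases hr with hr | hr
  · exact absurd (hr.trans_le (min_le_left _ _)) (not_lt.2 hr₁)
  · exact absurd (hr.trans_le (min_le_right _ _)) (not_lt.2 hr₂)

theorem excess_bound_of_forall_not_liesStrictlyBetween
    (h : ∀ ξ : StoneCech X, ¬ LiesStrictlyBetween p q ξ) {ε : ℝ} (hε : 0 < ε) :
    ∃ δ : ℝ, 0 < δ ∧ ∀ r : X, ε ≤ dist p r → ε ≤ dist q r → δ ≤ excess p q r := by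
  by_contra! hcon
  obtain ⟨r, hrp, hrq, -, hr0⟩ := exists_seq_excess_tendsto_zero hcon
  obtain ⟨ξ, -, hξ⟩ := (isCompact_univ (X := StoneCech X)).ultrafilter_le_nhds'
    ((hyperfilter ℕ).map fun n => stoneCechUnit (r n)) univ_mem
  have hξ' : Tendsto (fun n => stoneCechUnit (r n)) (hyperfilter ℕ) (𝓝 ξ) := hξ
  have hne : ∀ z : X, (∀ n, ε ≤ dist z (r n)) → ξ ≠ stoneCechUnit z := by
    rintro z hz rfl
    -- Taken with values in the compact space `[0,∞]`, the distance to `z` extends to `βX`, and so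
    -- separates `ξ` from `z`.
    have hc : Continuous fun x => ENNReal.ofReal (dist z x) :=
      ENNReal.continuous_ofReal.comp (continuous_const.dist continuous_id)
    have h1 := tendsto_stoneCechExtend hc hξ'
    rw [stoneCechExtend_stoneCechUnit, dist_self, ENNReal.ofReal_zero] at h1
    have h2 := ge_of_tendsto h1 (Eventually.of_forall fun n => ENNReal.ofReal_le_ofReal (hz n))
    exact absurd h2 (not_le.2 (ENNReal.ofReal_pos.2 hε))
  refine h ξ ⟨?_, hne p hrp, hne q hrq⟩
  refine tendsto_nhds_unique (tendsto_stoneCechExtend (continuous_excessENN p q) hξ') ?_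
  have := (ENNReal.continuous_ofReal.tendsto 0).comp (hr0.mono_left Nat.hyperfilter_le_atTop)
  rwa [ENNReal.ofReal_zero] at this

end StoneCechCompactification
end LipFree

theorem theorem4p1 {X : Type*} [MetricSpace X] (e p q : X) (hpq : p ≠ q) :
    List.TFAE [
      LipFree.IsPreservedExtremePoint (LipFree.molecule e p q),
      ∀ ξ : StoneCech X, ¬ LipFree.LiesStrictlyBetween p q ξ,
      ∀ ε : ℝ, 0 < ε → ∃ δ : ℝ, 0 < δ ∧
        ∀ r : X, ε ≤ dist p r → ε ≤ dist q r → δ ≤ LipFree.excess p q r] := by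
  -- `molecule` and `FreeSpace.molecule` agree by unfolding definitions.
  tfae_have 1 → 3 := fun h _ hε => LipFree.excess_bound_of_isPreservedExtremePoint hpq h hε
  tfae_have 3 → 1 := LipFree.isPreservedExtremePoint_molecule hpq
  tfae_have 2 → 3 := fun h _ hε => LipFree.excess_bound_of_forall_not_liesStrictlyBetween h hε
  tfae_have 3 → 2 := LipFree.not_liesStrictlyBetween
  tfae_finish
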